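/- Let $L/K$ be a finite separable field extension. A \emph{Hopf Galois structure} on $L/K$ is a pair $(H,\mu)$, where $H$ is a finite cocommutative $K$-Hopf algebra and $\mu\colon H\to \mathrm{End}_K(L)$ is a $K$-linear map that makes $L$ a left $H$-module algebra and for which the $K$-linear map $L\otimes_K H\to \mathrm{End}_K(L)$, $x\otimes h\mapsto (y\mapsto x\,\mu(h)(y))$, is bijective. Two Hopf Galois structures $(H,\mu)$ and $(H',\mu')$ on $L/K$ are \emph{isomorphic} if there is an isomorphism of $K$-Hopf algebras $\psi\colon H\to H'$ with $\mu'(\psi(h))=\mu(h)$ for all $h\in H$. Let $\widetilde L$ be a Galois closure of $L/K$, $G=\mathrm{Gal}(\widetilde L/K)$, $G'=\mathrm{Gal}(\widetilde L/L)$, and let $\lambda\colon G\to \mathrm{Sym}(G/G')$ be given by the action of $G$ on the left cosets of $G'$. If $N$ is a regular (that is, simply transitive) subgroup of $\mathrm{Sym}(G/G')$ normalized by $\lambda(G)$, let $G$ act on the group algebra $\widetilde L[N]$ through its action on $\widetilde L$ and by conjugation through $\lambda$ on $N$. A Hopf Galois structure on $L/K$ \emph{corresponds} to $N$ if it is isomorphic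 to the sub-$K$-Hopf algebra $\widetilde L[N]^G$ of $\widetilde L[N]$ acting on $L$ by $$\Bigl(\sum_{n\in N} c_n n\Bigr)\cdot x=\sum_{n\in N} c_n\,\bigl(n^{-1}(\overline{1})\bigr)(x)\qquad (x\in L),$$ where $\overline 1\in G/G'$ is the class of $1_G$ and $\overline{\sigma}(x)=\sigma(x)$ for $\overline\sigma\in G/G'$, $x\in L$. A Hopf Galois structure is \emph{almost classically Galois} if it corresponds to such an $N$ whose centralizer in $\mathrm{Sym}(G/G')$ is contained in $\lambda(G)$. \textbf{Proposition.} Let $(H,\mu)$ be an almost classically Galois Hopf Galois structure on $L/K$ and let $(H',\mu')$ be any Hopf Galois structure on $L/K$. If $H$ and $H'$ are isomorphic as $K$-Hopf algebras, then the Hopf Galois structures $(H,\mu)$ and $(H',\mu')$ are isomorphic. In other words, up to isomorphism, $(H,\mu)$ is the only Hopf Galois structure on $L/K$ whose Hopf algebra is isomorphic to $H$. -/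

import Mathlib

open scoped TensorProduct

noncomputable section

/-- A Hopf Galois structure on `L/K` with underlying finite cocommutative `K`-Hopf algebra `H`:
an action of `H` on `L` which makes `L` a left `H`-module algebra and for which the map
`L ⊗[K] H → End_K(L)`, `x ⊗ h ↦ (y ↦ x * (h • y))`, is bijective. -/
structure HopfGaloisStructure (K L H : Type*) [Field K] [Field L] [Algebra K L]
    [Ring H] [HopfAlgebra K H] [Coalgebra.IsCocomm K H] [Module.Finite K H] where
  /-- The action `μ : H → End_K(L)`. -/
  action : H →ₐ[K] Module.End K L
  /-- `h • 1 = ε(h) 1`. -/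
  action_one : ∀ h : H, action h 1 = algebraMap K L (Coalgebra.counit (R := K) h)
  /-- `h • (x y) = ∑ (h₍₁₎ • x) (h₍₂₎ • y)`. -/
  action_mul : ∀ (h : H) (x y : L),
    action h (x * y) =
      LinearMap.mul' K L
        (TensorProduct.map (LinearMap.applyₗ x ∘ₗ action.toLinearMap)
          (LinearMap.applyₗ y ∘ₗ action.toLinearMap) (Coalgebra.comul (R := K) h))
  /-- The map `L ⊗[K] H → End_K(L)` is bijective. -/
  galois : Function.Bijective
    (TensorProduct.lift
      ((LinearMap.mul K (Module.End K L)).compl₁₂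
        (Algebra.lmul K L).toLinearMap action.toLinearMap))

namespace HopfGaloisStructure

/-- Two Hopf Galois structures on `L/K` are isomorphic if there is an isomorphism of `K`-Hopf
algebras between the underlying Hopf algebras which is compatible with the actions on `L`
(a bialgebra isomorphism of Hopf algebras automatically preserves antipodes). -/
def Isomorphic {K L H H' : Type*} [Field K] [Field L] [Algebra K L]
    [Ring H] [HopfAlgebra K H] [Coalgebra.IsCocomm K H] [Module.Finite K H]
    [Ring H'] [HopfAlgebra K H'] [Coalgebra.IsCocomm K H'] [Module.Finite K H']
    (S : HopfGaloisStructure K L H) (S' : HopfGaloisStructure K L H') : Prop :=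
  ∃ e : H ≃ₐc[K] H', ∀ h : H, S'.action (e h) = S.action h

end HopfGaloisStructure

namespace GreitherPareigis

/-- For a tower `K ⊆ L ⊆ E`, the subgroup `G' = Gal(E/L)` of `G = Gal(E/K)`. -/
def stabilizer (K L E : Type*) [Field K] [Field L] [Field E] [Algebra K L] [Algebra K E]
    [Algebra L E] [IsScalarTower K L E] : Subgroup (E ≃ₐ[K] E) :=
  (IsScalarTower.toAlgHom K L E).fieldRange.fixingSubgroup

variable (K L E : Type*) [Field K] [Field L] [Field E] [Algebra K L] [Algebra K E]
  [Algebra L E] [IsScalarTower K L E]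

/-- The set `G/G'` of left cosets, `G = Gal(E/K)`, `G' = Gal(E/L)`. -/
abbrev Cosets : Type _ := (E ≃ₐ[K] E) ⧸ stabilizer K L E

/-- The action `λ : G → Sym(G/G')` of `G` on left cosets. -/
def lam : (E ≃ₐ[K] E) →* Equiv.Perm (Cosets K L E) :=
  MulAction.toPermHom (E ≃ₐ[K] E) (Cosets K L E)

variable {K L E}

/-- The value `σ(x) ∈ E` of a coset `σG' ∈ G/G'` at an element `x ∈ L`. -/
def cosetEval (q : Cosets K L E) (x : L) : E :=
  Quotient.liftOn' q (fun σ => σ (algebraMap L E x)) (by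
    intro σ τ h
    rw [QuotientGroup.leftRel_apply] at h
    have h1 : (σ⁻¹ * τ) (algebraMap L E x) = algebraMap L E x :=
      (IntermediateField.mem_fixingSubgroup_iff _ _).1 h _ ⟨x, rfl⟩
    have h2 : τ (algebraMap L E x) = σ ((σ⁻¹ * τ) (algebraMap L E x)) := by
      rw [← AlgEquiv.mul_apply, mul_inv_cancel_left]
    change σ (algebraMap L E x) = τ (algebraMap L E x)
    rw [h2, h1])

/-- A group `N` of permutations of `X` is regular if it acts simply transitively on `X`. -/
def IsRegular {X : Type*} (N : Subgroup (Equiv.Perm X)) : Prop :=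
  ∀ x y : X, ∃! n : N, (n : Equiv.Perm X) x = y

/-- Invariance of `c = ∑ c_n n ∈ E[N]` under `G`, which acts on `E` by field automorphisms and on
`N` by conjugation through `λ`: the coefficient of `c` at `λ(g) n λ(g)⁻¹` is `g(c_n)`. -/
def IsInvariant {N : Subgroup (Equiv.Perm (Cosets K L E))} (c : MonoidAlgebra E N) : Prop :=
  ∀ (g : E ≃ₐ[K] E) (n m : N),
    (m : Equiv.Perm (Cosets K L E)) = lam K L E g * n * (lam K L E g)⁻¹ →
      c.coeff m = g (c.coeff n)

/-- The Hopf Galois structure `S` corresponds to the subgroup `N` of `Sym(G/G')`: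
`N` is regular and normalized by `λ(G)`, and `S` is identified, by means of `ι`, with the
sub-`K`-Hopf algebra `E[N]^G` of `E[N]` acting on `L` by
`(∑ c_n n) • x = ∑ c_n (n⁻¹(1G'))(x)`. -/
def Corresponds {H : Type*} [Ring H] [HopfAlgebra K H] [Coalgebra.IsCocomm K H]
    [Module.Finite K H] (S : HopfGaloisStructure K L H)
    (N : Subgroup (Equiv.Perm (Cosets K L E))) : Prop :=
  IsRegular N ∧
  (lam K L E).range ≤ Subgroup.normalizer (N : Set (Equiv.Perm (Cosets K L E))) ∧
  ∃ ι : H →ₐ[K] MonoidAlgebra E N,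
    Function.Injective ι ∧
    Set.range ι = {c | IsInvariant c} ∧
    (∀ h : H, Coalgebra.counit (R := E) (ι h) =
      algebraMap K E (Coalgebra.counit (R := K) h)) ∧
    (∀ h : H, Coalgebra.comul (R := E) (ι h) =
      TensorProduct.mapOfCompatibleSMul E K K (MonoidAlgebra E N) (MonoidAlgebra E N)
        (TensorProduct.map ι.toLinearMap ι.toLinearMap (Coalgebra.comul (R := K) h))) ∧
    (∀ (h : H) (x : L), algebraMap L E (S.action h x) =
      (ι h).coeff.sum fun n c =>
        c * cosetEval ((n : Equiv.Perm (Cosets K L E))⁻¹ ((1 : E ≃ₐ[K] E) : Cosets K L E)) x)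

variable (E) in
/-- With `E` a Galois closure of `L/K`: the structure `S` is almost classically Galois if the
corresponding regular subgroup `N` of `Sym(G/G')` has its centralizer contained in `λ(G)`. -/
def IsAlmostClassicallyGalois {H : Type*} [Ring H] [HopfAlgebra K H] [Coalgebra.IsCocomm K H]
    [Module.Finite K H] (S : HopfGaloisStructure K L H) : Prop :=
  ∃ N : Subgroup (Equiv.Perm (Cosets K L E)), Corresponds S N ∧
    Subgroup.centralizer (N : Set (Equiv.Perm (Cosets K L E))) ≤ (lam K L E).range

end GreitherPareigis

end

/-! Transport `S'` to `H` along the given isomorphism, so that one Hopf algebra `H` acts twice.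
Since `E ⊗ H` is `E[N]` (`exists_baseChangeEquiv`), any Hopf Galois action of `H` lets `E[N]` act on
`Hom_K(L, E)` by precomposition. Elements of `N` are group-like, hence preserve algebra
homomorphisms `L → E`, which are the cosets `G/G'`. So `N` permutes `G/G'`, compatibly with `λ(G)`.

If `c = λ(g)` centralizes `N`, this compatibility says that the new permutations commute with `c`.
By hypothesis this covers the whole centralizer of `N`, and a regular group is its own double
centralizer, so the new permutations lie in `N`. They define a `G`-equivariant automorphism `α` of
`N` (`exists_mulEquiv_action_eq`). It descends to an automorphism of `H` (`exists_bialgEquiv`),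
which carries one action to the other. -/

namespace IsNormalClosure

/-! ### The normal closure is finite and Galois -/

variable (K L E : Type*) [Field K] [Field L] [Field E] [Algebra K L] [Algebra K E]
  [FiniteDimensional K L] [IsNormalClosure K L E]

theorem normalClosure_eq_top : IntermediateField.normalClosure K L E = ⊤ :=
  (Algebra.IsAlgebraic.isNormalClosure_iff.1 (inferInstanceAs (IsNormalClosure K L E))).2

include L in
theorem finiteDimensional : FiniteDimensional K E := by
  have h : FiniteDimensional K (IntermediateField.normalClosure K L E) := inferInstance
  rw [normalClosure_eq_top K L E] at h
  exact IntermediateField.topEquiv.toLinearEquiv.finiteDimensional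

include L in
theorem isGalois [Algebra.IsSeparable K L] : IsGalois K E := by
  have : Normal K E := IsNormalClosure.normal (K := L)
  have hsep (f : L →ₐ[K] E) : Algebra.IsSeparable K f.fieldRange :=
    AlgEquiv.Algebra.isSeparable (AlgEquiv.ofInjectiveField f)
  have h : Algebra.IsSeparable K (IntermediateField.normalClosure K L E) :=
    IntermediateField.isSeparable_iSup (h := hsep)
  rw [normalClosure_eq_top K L E] at h
  have : Algebra.IsSeparable K E := AlgEquiv.Algebra.isSeparable IntermediateField.topEquiv
  exact { }

end IsNormalClosure

namespace GreitherPareigis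

/-! ### Cosets of `G'` as embeddings of `L` into `E` -/

section Cosets

variable {K L E : Type*} [Field K] [Field L] [Field E] [Algebra K L] [Algebra K E]
  [Algebra L E] [IsScalarTower K L E]

theorem cosetEval_mk (σ : E ≃ₐ[K] E) (x : L) :
    cosetEval (σ : Cosets K L E) x = σ (algebraMap L E x) := rfl

/-- The `K`-algebra homomorphism `L → E` attached to a coset. -/
noncomputable def cosetAlgHom (q : Cosets K L E) : L →ₐ[K] E where
  toFun := cosetEval q
  map_one' := by induction q using QuotientGroup.induction_on; simp [cosetEval_mk]
  map_mul' x y := by induction q using QuotientGroup.induction_on; simp [cosetEval_mk]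
  map_zero' := by induction q using QuotientGroup.induction_on; simp [cosetEval_mk]
  map_add' x y := by induction q using QuotientGroup.induction_on; simp [cosetEval_mk]
  commutes' r := by
    induction q using QuotientGroup.induction_on
    simp [cosetEval_mk, ← IsScalarTower.algebraMap_apply]

@[simp]
theorem cosetAlgHom_apply (q : Cosets K L E) (x : L) : cosetAlgHom q x = cosetEval q x := rfl

theorem cosetEval_lam (g : E ≃ₐ[K] E) (q : Cosets K L E) (x : L) :
    cosetEval (lam K L E g q) x = g (cosetEval q x) := by
  induction q using QuotientGroup.induction_on
  rfl

theorem cosetAlgHom_injective :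
    Function.Injective (cosetAlgHom : Cosets K L E → (L →ₐ[K] E)) := by
  intro p q h
  induction p using QuotientGroup.induction_on with | H σ => ?_
  induction q using QuotientGroup.induction_on with | H τ => ?_
  rw [QuotientGroup.eq]
  refine (IntermediateField.mem_fixingSubgroup_iff _ _).2 ?_
  rintro _ ⟨x, rfl⟩
  have hx : σ (algebraMap L E x) = τ (algebraMap L E x) := DFunLike.congr_fun h x
  change σ.symm (τ (algebraMap L E x)) = algebraMap L E x
  rw [← hx, AlgEquiv.symm_apply_apply]

theorem cosetAlgHom_surjective [Normal K E] :
    Function.Surjective (cosetAlgHom : Cosets K L E → (L →ₐ[K] E)) := by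
  intro f
  let e : L ≃ₐ[K] f.fieldRange := AlgEquiv.ofInjectiveField f
  refine ⟨((e.liftNormal E : E ≃ₐ[K] E) : Cosets K L E), ?_⟩
  ext x
  exact e.liftNormal_commutes E x

theorem card_cosets [FiniteDimensional K E] [IsGalois K E] :
    Nat.card (Cosets K L E) = Module.finrank K L := by
  have h :=
    IntermediateField.finrank_eq_fixingSubgroup_index E (IsScalarTower.toAlgHom K L E).fieldRange
  let e : L ≃ₐ[K] (IsScalarTower.toAlgHom K L E).fieldRange :=
    AlgEquiv.ofInjectiveField (IsScalarTower.toAlgHom K L E)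
  exact (e.toLinearEquiv.finrank_eq.trans h).symm

end Cosets

/-! ### Regular permutation groups and their centralizers -/

section Permutations

variable {X : Type*} {N : Subgroup (Equiv.Perm X)}

theorem IsRegular.card_eq [Nonempty X] (h : IsRegular N) : Nat.card N = Nat.card X := by
  obtain ⟨x⟩ := ‹Nonempty X›
  refine Nat.card_congr (Equiv.ofBijective (fun n : N => (n : Equiv.Perm X) x) ⟨?_, ?_⟩)
  · intro m n hmn
    exact (h x ((n : Equiv.Perm X) x)).unique hmn rfl
  · intro y
    exact (h x y).exists

theorem IsRegular.ext_apply (h : IsRegular N) {m n : N} (x : X)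
    (hmn : (m : Equiv.Perm X) x = (n : Equiv.Perm X) x) : m = n :=
  (h x ((n : Equiv.Perm X) x)).unique hmn rfl

/-- The centralizer of a regular permutation group is transitive. -/
theorem IsRegular.exists_mem_centralizer (h : IsRegular N) (x y : X) :
    ∃ c ∈ Subgroup.centralizer (N : Set (Equiv.Perm X)), c x = y := by
  let φ : N ≃ X := Equiv.ofBijective (fun n : N => (n : Equiv.Perm X) x)
    ⟨fun m n hmn => h.ext_apply x hmn, fun y => (h x y).exists⟩
  have hφ : ∀ n : N, φ n = (n : Equiv.Perm X) x := fun _ => rfl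
  obtain ⟨k, hk⟩ := (h x y).exists
  -- Under `φ`, the group `N` acts on itself by left multiplication, which commutes with right
  -- multiplication by `k`.
  refine ⟨φ.symm.trans ((Equiv.mulRight k).trans φ), ?_, ?_⟩
  · rw [Subgroup.mem_centralizer_iff]
    intro n hn
    ext z
    obtain ⟨m, rfl⟩ := φ.surjective z
    have h1 : n (φ m) = φ (⟨n, hn⟩ * m) := rfl
    simp only [Equiv.Perm.mul_apply, Equiv.trans_apply, h1, Equiv.symm_apply_apply,
      Equiv.coe_mulRight, mul_assoc]
    rfl
  · have hx : φ.symm x = 1 := φ.symm_apply_apply 1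
    simp [hx, hφ, hk]

/-- A map commuting with the centralizer of a regular permutation group belongs to the group. -/
theorem IsRegular.exists_eq_of_commute (h : IsRegular N) [Nonempty X] (p : X → X)
    (hp : ∀ c ∈ Subgroup.centralizer (N : Set (Equiv.Perm X)), ∀ x, p (c x) = c (p x)) :
    ∃ n : N, ∀ x, (n : Equiv.Perm X) x = p x := by
  obtain ⟨x₀⟩ := ‹Nonempty X›
  obtain ⟨n, hn⟩ := (h x₀ (p x₀)).exists
  refine ⟨n, fun x => ?_⟩
  -- Both `n` and `p` commute with `c`, so their agreement at `x₀` propagates to `c x₀`.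
  obtain ⟨c, hc, rfl⟩ := h.exists_mem_centralizer x₀ x
  rw [hp c hc, ← hn]
  exact DFunLike.congr_fun (Subgroup.mem_centralizer_iff.1 hc n n.2) x₀

end Permutations

/-! ### Galois descent for `E[N]` -/

section Descent

variable {K L E : Type*} [Field K] [Field L] [Field E] [Algebra K L] [Algebra K E]
  [Algebra L E] [IsScalarTower K L E] {N : Subgroup (Equiv.Perm (Cosets K L E))}

/-- Conjugation by `λ(g)` on a subgroup normalized by `λ(G)`. -/
def conjLam (hN : (lam K L E).range ≤ Subgroup.normalizer (N : Set (Equiv.Perm (Cosets K L E))))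
    (g : E ≃ₐ[K] E) (n : N) : N :=
  ⟨lam K L E g * n * (lam K L E g)⁻¹,
    (Subgroup.mem_normalizer_iff.1 (hN ⟨g, rfl⟩) n).1 n.2⟩

variable (hN : (lam K L E).range ≤ Subgroup.normalizer (N : Set (Equiv.Perm (Cosets K L E))))

theorem coe_conjLam (g : E ≃ₐ[K] E) (n : N) :
    (conjLam hN g n : Equiv.Perm (Cosets K L E)) = lam K L E g * n * (lam K L E g)⁻¹ := rfl

theorem conjLam_one (n : N) : conjLam hN 1 n = n := by
  ext1; simp [coe_conjLam]

theorem conjLam_mul (g h : E ≃ₐ[K] E) (n : N) :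
    conjLam hN (g * h) n = conjLam hN g (conjLam hN h n) := by
  ext1; simp [coe_conjLam, mul_assoc]

theorem conjLam_injective (g : E ≃ₐ[K] E) : Function.Injective (conjLam hN g) := by
  intro m n h
  simpa [← conjLam_mul, conjLam_one] using congrArg (conjLam hN g⁻¹) h

theorem conjLam_inv (g : E ≃ₐ[K] E) (n : N) : (conjLam hN g n)⁻¹ = conjLam hN g n⁻¹ := by
  ext1; simp [coe_conjLam, mul_assoc]

theorem isInvariant_iff {c : MonoidAlgebra E N} :
    IsInvariant c ↔ ∀ g n, c.coeff (conjLam hN g n) = g (c.coeff n) :=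
  ⟨fun h g n => h g n _ rfl, fun h g n m hm => by
    rw [show m = conjLam hN g n from Subtype.ext hm, h]⟩

/-- This is the trace over `G` of `a n`; acting by `h` only reindexes the sum. Such traces are the
supply of invariants for descent. -/
theorem isInvariant_sum_single [Fintype (E ≃ₐ[K] E)] (a : E) (n : N) :
    IsInvariant (∑ g : E ≃ₐ[K] E, MonoidAlgebra.single (conjLam hN g n) (g a)) := by
  classical
  rw [isInvariant_iff hN]
  intro h m
  simp only [MonoidAlgebra.coeff_sum, Finsupp.coe_finsetSum, Finset.sum_apply,
    MonoidAlgebra.coeff_single, Finsupp.single_apply, map_sum]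
  refine (Fintype.sum_equiv (Equiv.mulLeft h) _ _ fun g => ?_).symm
  simp only [Equiv.coe_mulLeft, conjLam_mul, (conjLam_injective hN h).eq_iff]
  split_ifs <;> simp

include hN in
/-- Galois descent: the invariants span the group algebra over `E`. -/
theorem span_isInvariant_eq_top [Finite (E ≃ₐ[K] E)] :
    Submodule.span E {c : MonoidAlgebra E N | IsInvariant c} = ⊤ := by
  have := Fintype.ofFinite (E ≃ₐ[K] E)
  by_contra hne
  obtain ⟨f, hf, hle⟩ := Submodule.exists_le_ker_of_lt_top _ (lt_top_iff_ne_top.2 hne)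
  refine hf (LinearMap.ext fun c => ?_)
  induction c using MonoidAlgebra.induction_linear with
  | zero => simp
  | add c d hc hd => simp [hc, hd]
  | single n r =>
    -- As `f` kills the traces of `a n` for every `a`, its values on the conjugates of `n` are
    -- coefficients of a linear relation between automorphisms of `E`; Dedekind's independence makes
    -- them vanish.
    have key : ∀ g : E ≃ₐ[K] E, f (MonoidAlgebra.single (conjLam hN g n) 1) = 0 := by
      refine Fintype.linearIndependent_iff.1
        ((linearIndependent_toLinearMap K E E).comp (fun g : E ≃ₐ[K] E => (g : E →ₐ[K] E))
          (fun g h hgh => AlgEquiv.ext fun x => DFunLike.congr_fun hgh x)) _ ?_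
      ext a
      have h := hle (Submodule.subset_span (isInvariant_sum_single hN a n))
      rw [LinearMap.mem_ker, map_sum] at h
      rw [LinearMap.zero_apply, ← h, LinearMap.sum_apply]
      refine Finset.sum_congr rfl fun g _ => ?_
      rw [← mul_one (g a), ← smul_eq_mul, ← MonoidAlgebra.smul_single, map_smul]
      simp [mul_comm]
    have h1 := key 1
    rw [conjLam_one] at h1
    rw [← mul_one r, ← smul_eq_mul, ← MonoidAlgebra.smul_single, map_smul, h1]
    simp

end Descent

end GreitherPareigis

namespace HopfGaloisStructure

/-! ### The Galois condition over `E` -/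

section Orbit

variable {K L E H H' : Type*} [Field K] [Field L] [Field E] [Algebra K L] [Algebra K E]
  [Ring H] [HopfAlgebra K H] [Coalgebra.IsCocomm K H] [Module.Finite K H]
  [Ring H'] [HopfAlgebra K H'] [Coalgebra.IsCocomm K H'] [Module.Finite K H']
  (S : HopfGaloisStructure K L H)

/-- The pullback of a Hopf Galois structure along an isomorphism of Hopf algebras. -/
noncomputable def comap (S : HopfGaloisStructure K L H') (e : H ≃ₐc[K] H') :
    HopfGaloisStructure K L H where
  action := S.action.comp (e : H →ₐ[K] H')
  action_one h := by
    change S.action (e h) 1 = _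
    rw [S.action_one, CoalgHomClass.counit_comp_apply]
  action_mul h x y := by
    change S.action (e h) (x * y) = _
    rw [S.action_mul, ← CoalgHomClass.map_comp_comul_apply]
    induction Coalgebra.comul (R := K) h using TensorProduct.induction_on with
    | zero => simp
    | add s t hs ht => simp only [map_add, hs, ht]
    | tmul a b => rfl
  galois := by
    have h : TensorProduct.lift ((LinearMap.mul K (Module.End K L)).compl₁₂
        (Algebra.lmul K L).toLinearMap (S.action.comp (e : H →ₐ[K] H')).toLinearMap) =
        TensorProduct.lift ((LinearMap.mul K (Module.End K L)).compl₁₂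
          (Algebra.lmul K L).toLinearMap S.action.toLinearMap) ∘ₗ
          (TensorProduct.congr (LinearEquiv.refl K L)
            (e : H ≃ₐ[K] H').toLinearEquiv).toLinearMap := by
      ext x h y
      rfl
    rw [h, LinearMap.coe_comp]
    exact S.galois.comp (LinearEquiv.bijective _)

theorem comap_action (S : HopfGaloisStructure K L H') (e : H ≃ₐc[K] H') (h : H) :
    (S.comap e).action h = S.action (e h) := rfl

include S in
theorem finrank_eq [FiniteDimensional K L] : Module.finrank K H = Module.finrank K L := by
  have h := (LinearEquiv.ofBijective _ S.galois).finrank_eq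
  rw [Module.finrank_tensorProduct, Module.finrank_linearMap] at h
  exact Nat.eq_of_mul_eq_mul_left Module.finrank_pos h

/-- The `E`-linear extension of `h ↦ φ ∘ (h • ·)`. -/
noncomputable def orbit (φ : L →ₗ[K] E) : E ⊗[K] H →ₗ[E] (L →ₗ[K] E) :=
  (LinearMap.compRight K φ ∘ₗ S.action.toLinearMap).liftBaseChange E

@[simp]
theorem orbit_tmul (φ : L →ₗ[K] E) (a : E) (h : H) (x : L) :
    S.orbit φ (a ⊗ₜ h) x = a * φ (S.action h x) := by
  simp [orbit]

theorem orbit_surjective [FiniteDimensional K L] (φ : L →ₐ[K] E) :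
    Function.Surjective (S.orbit φ.toLinearMap) := by
  have key : ∀ f : Module.End K L,
      φ.toLinearMap ∘ₗ f ∈ LinearMap.range (S.orbit φ.toLinearMap) := by
    intro f
    obtain ⟨t, rfl⟩ := S.galois.2 f
    induction t using TensorProduct.induction_on with
    | zero => rw [map_zero, LinearMap.comp_zero]; exact zero_mem _
    | add s t hs ht => rw [map_add, LinearMap.comp_add]; exact add_mem hs ht
    | tmul x h =>
      refine ⟨φ x ⊗ₜ h, ?_⟩
      ext y
      simp
  intro f
  let b := Module.finBasis K L
  -- The rank-one endomorphisms with values in `K · 1`, composed with `φ`, give the dual basis,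
  -- which spans `Hom_K(L, E)` over `E`.
  have hf : f = ∑ i, f (b i) • (φ.toLinearMap ∘ₗ (b.coord i).smulRight (1 : L)) := by
    refine b.ext fun j => ?_
    simp [LinearMap.sum_apply, Finsupp.single_apply, apply_ite]
  rw [← LinearMap.mem_range, hf]
  exact sum_mem fun i _ => Submodule.smul_mem _ _ (key _)

theorem orbit_injective [FiniteDimensional K L] (φ : L →ₐ[K] E) :
    Function.Injective (S.orbit φ.toLinearMap) := by
  have h : Module.finrank E (E ⊗[K] H) = Module.finrank E (L →ₗ[K] E) := by
    rw [Module.finrank_baseChange, Module.finrank_linearMap, Module.finrank_self, mul_one,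
      S.finrank_eq]
  have : Module.Finite E (L →ₗ[K] E) := Module.Finite.of_surjective _ (S.orbit_surjective φ)
  exact (LinearMap.injective_iff_surjective_of_finrank_eq_finrank h).2 (S.orbit_surjective φ)

theorem orbit_rTensor (φ : L →ₗ[K] E) (g : E ≃ₐ[K] E) (t : E ⊗[K] H) (x : L) :
    S.orbit (g.toLinearMap ∘ₗ φ) (g.toLinearMap.rTensor H t) x = g (S.orbit φ t x) := by
  induction t using TensorProduct.induction_on with
  | zero => simp
  | add s t hs ht => simp only [map_add, LinearMap.add_apply, hs, ht]
  | tmul a h => simp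

end Orbit

/-! ### The right action of `E[N]` on `Hom_K(L, E)` -/

section Transfer

variable {K L E H N : Type*} [Field K] [Field L] [Field E] [Algebra K L] [Algebra K E]
  [Ring H] [HopfAlgebra K H] [Coalgebra.IsCocomm K H] [Module.Finite K H] [Group N]
  (S : HopfGaloisStructure K L H) (ι : H →ₐ[K] MonoidAlgebra E N)
  (e : E ⊗[K] H ≃ₗ[E] MonoidAlgebra E N) (he : ∀ h, e (1 ⊗ₜ h) = ι h)

omit [Coalgebra.IsCocomm K H] [Module.Finite K H] in
include he in
theorem linearMap_ext_of_baseChange {V : Type*} [AddCommGroup V] [Module E V]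
    {f g : MonoidAlgebra E N →ₗ[E] V} (h : ∀ x, f (ι x) = g (ι x)) : f = g := by
  refine LinearMap.ext fun c => ?_
  obtain ⟨t, rfl⟩ := e.surjective c
  induction t using TensorProduct.induction_on with
  | zero => simp
  | add s t hs ht => simp only [map_add, hs, ht]
  | tmul a x =>
    have hx : (a ⊗ₜ[K] x : E ⊗[K] H) = a • (1 ⊗ₜ x) := by simp [TensorProduct.smul_tmul']
    simp [hx, he, h]

/-- The action of `E[N]` on the `K`-linear maps `L → E` (from the right) obtained from the action
of `H` on `L`, when `E[N]` is identified with `E ⊗ H`. -/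
noncomputable def transfer (φ : L →ₗ[K] E) : MonoidAlgebra E N →ₗ[E] (L →ₗ[K] E) :=
  S.orbit φ ∘ₗ e.symm.toLinearMap

include he in
theorem transfer_form (φ : L →ₗ[K] E) (h : H) (x : L) :
    S.transfer e φ (ι h) x = φ (S.action h x) := by
  simp [transfer, ← he]

omit [Group N] in
theorem transfer_injective [FiniteDimensional K L] (φ : L →ₐ[K] E) :
    Function.Injective (S.transfer e φ.toLinearMap) :=
  (S.orbit_injective φ).comp e.symm.injective

include he in
theorem transfer_add (φ ψ : L →ₗ[K] E) :
    S.transfer e (φ + ψ) = S.transfer e φ + S.transfer e ψ :=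
  linearMap_ext_of_baseChange ι e he fun h => by
    ext x
    simp [S.transfer_form ι e he]

include he in
theorem transfer_smul (a : E) (φ : L →ₗ[K] E) :
    S.transfer e (a • φ) = a • S.transfer e φ :=
  linearMap_ext_of_baseChange ι e he fun h => by
    ext x
    simp [S.transfer_form ι e he]

include he in
-- On `ι(H)` this is associativity of composition. Linearity in `φ` makes both sides `E`-bilinear in
-- `a` and `b`, so checking there suffices.
theorem transfer_mul (φ : L →ₗ[K] E) (a b : MonoidAlgebra E N) :
    S.transfer e φ (a * b) = S.transfer e (S.transfer e φ a) b := by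
  let R : MonoidAlgebra E N →ₗ[E] (L →ₗ[K] E) :=
    { toFun := fun a => S.transfer e (S.transfer e φ a) b
      map_add' := fun a a' => by rw [map_add, S.transfer_add ι e he, LinearMap.add_apply]
      map_smul' := fun r a => by
        rw [map_smul, S.transfer_smul ι e he, LinearMap.smul_apply, RingHom.id_apply] }
  have : S.transfer e φ ∘ₗ LinearMap.mulRight E b = R := by
    refine linearMap_ext_of_baseChange ι e he fun h => ?_
    change S.transfer e φ (ι h * b) = S.transfer e (S.transfer e φ (ι h)) b
    have : S.transfer e φ ∘ₗ LinearMap.mulLeft E (ι h) = S.transfer e (S.transfer e φ (ι h)) := by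
      refine linearMap_ext_of_baseChange ι e he fun h' => ?_
      ext x
      simp only [LinearMap.comp_apply, LinearMap.mulLeft_apply]
      rw [← map_mul, S.transfer_form ι e he, S.transfer_form ι e he, S.transfer_form ι e he,
        map_mul, Module.End.mul_apply]
    exact LinearMap.congr_fun this b
  exact LinearMap.congr_fun this a

include he in
theorem transfer_apply_one
    (hcounit : ∀ h : H, Coalgebra.counit (R := E) (ι h) =
      algebraMap K E (Coalgebra.counit (R := K) h))
    (φ : L →ₐ[K] E) (a : MonoidAlgebra E N) :
    S.transfer e φ.toLinearMap a 1 = Coalgebra.counit (R := E) a := by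
  have h : LinearMap.applyₗ' E (1 : L) ∘ₗ S.transfer e φ.toLinearMap =
      Coalgebra.counit (R := E) (A := MonoidAlgebra E N) := by
    refine linearMap_ext_of_baseChange ι e he fun h => ?_
    rw [hcounit]
    simp [S.transfer_form ι e he, S.action_one]
  exact LinearMap.congr_fun h a

include he in
-- The module algebra axiom extends `E`-linearly from `H` to `E[N]`, where `n` is group-like.
theorem transfer_apply_mul
    (hcomul : ∀ h : H, Coalgebra.comul (R := E) (ι h) =
      TensorProduct.mapOfCompatibleSMul E K K (MonoidAlgebra E N) (MonoidAlgebra E N)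
        (TensorProduct.map ι.toLinearMap ι.toLinearMap (Coalgebra.comul (R := K) h)))
    (φ : L →ₐ[K] E) (n : N) (x y : L) :
    S.transfer e φ.toLinearMap (MonoidAlgebra.single n 1) (x * y) =
      S.transfer e φ.toLinearMap (MonoidAlgebra.single n 1) x *
        S.transfer e φ.toLinearMap (MonoidAlgebra.single n 1) y := by
  let T (x : L) : MonoidAlgebra E N →ₗ[E] E :=
    LinearMap.applyₗ' E x ∘ₗ S.transfer e φ.toLinearMap
  have hT : ∀ h x, T x (ι h) = φ (S.action h x) := fun h x => S.transfer_form ι e he _ h x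
  have key : T (x * y) =
      LinearMap.mul' E E ∘ₗ TensorProduct.map (T x) (T y) ∘ₗ Coalgebra.comul (R := E) := by
    refine linearMap_ext_of_baseChange ι e he fun h => ?_
    rw [hT, LinearMap.comp_apply, LinearMap.comp_apply, hcomul, S.action_mul]
    induction Coalgebra.comul (R := K) h using TensorProduct.induction_on with
    | zero => simp
    | add s t hs ht => simp only [map_add, hs, ht]
    | tmul h h' => simp [hT]
  simpa [T] using LinearMap.congr_fun key (MonoidAlgebra.single n 1)

omit [Coalgebra.IsCocomm K H] [Module.Finite K H] in
include he in
theorem baseChange_rTensor_coeff (g : E ≃ₐ[K] E) (c : N → N)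
    (hc : ∀ h m, (ι h).coeff (c m) = g ((ι h).coeff m)) (t : E ⊗[K] H) (m : N) :
    (e (g.toLinearMap.rTensor H t)).coeff (c m) = g ((e t).coeff m) := by
  induction t using TensorProduct.induction_on with
  | zero => simp
  | add s t hs ht => simp only [map_add, MonoidAlgebra.coeff_add, Finsupp.add_apply, hs, ht]
  | tmul a x =>
    have hx (a : E) : (a ⊗ₜ[K] x : E ⊗[K] H) = a • (1 ⊗ₜ x) := by simp [TensorProduct.smul_tmul']
    rw [LinearMap.rTensor_tmul, hx, hx a]
    simp [he, hc]

include he in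
-- By `hc`, the map `g ⊗ 1` on `E ⊗ H` becomes `g` on coefficients combined with `c` on `N`, so it
-- sends `n` to `c n`.
theorem transfer_conj (g : E ≃ₐ[K] E) (c : Equiv.Perm N)
    (hc : ∀ h m, (ι h).coeff (c m) = g ((ι h).coeff m)) (φ : L →ₗ[K] E) (n : N) (x : L) :
    S.transfer e (g.toLinearMap ∘ₗ φ) (MonoidAlgebra.single (c n) 1) x =
      g (S.transfer e φ (MonoidAlgebra.single n 1) x) := by
  classical
  have h : e (g.toLinearMap.rTensor H (e.symm (MonoidAlgebra.single n 1))) =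
      MonoidAlgebra.single (c n) 1 := by
    ext m
    obtain ⟨m, rfl⟩ := c.surjective m
    rw [baseChange_rTensor_coeff ι e he g c hc]
    simp [Finsupp.single_apply, apply_ite g]
  rw [← h]
  simp [transfer, S.orbit_rTensor]

end Transfer

end HopfGaloisStructure

namespace GreitherPareigis

/-! ### Twisting the action by automorphisms of `N` -/

section Form

variable {K L E H : Type*} [Field K] [Field L] [Field E] [Algebra K L] [Algebra K E]
  [Algebra L E] [IsScalarTower K L E]
  [Ring H] [HopfAlgebra K H] [Coalgebra.IsCocomm K H] [Module.Finite K H]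
  {N : Subgroup (Equiv.Perm (Cosets K L E))}
  (hN : (lam K L E).range ≤ Subgroup.normalizer (N : Set (Equiv.Perm (Cosets K L E))))
  {ι : H →ₐ[K] MonoidAlgebra E N} (hinj : Function.Injective ι)
  (hrange : Set.range ι = {c | IsInvariant c})

omit [Coalgebra.IsCocomm K H] in
include hN hrange in
theorem exists_baseChangeEquiv [FiniteDimensional K E] [IsGalois K E] (hreg : IsRegular N)
    (hfin : Module.finrank K H = Module.finrank K L) :
    ∃ e : E ⊗[K] H ≃ₗ[E] MonoidAlgebra E N, ∀ h, e (1 ⊗ₜ h) = ι h := by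
  have hsurj : Function.Surjective (ι.toLinearMap.liftBaseChange E) := by
    rw [← LinearMap.range_eq_top, eq_top_iff, ← span_isInvariant_eq_top hN, Submodule.span_le,
      ← hrange]
    rintro _ ⟨h, rfl⟩
    exact ⟨1 ⊗ₜ h, by simp⟩
  have : Fintype N := Fintype.ofFinite N
  have hdim : Module.finrank E (E ⊗[K] H) = Module.finrank E (MonoidAlgebra E N) := by
    rw [Module.finrank_baseChange, hfin, ← card_cosets (E := E), ← hreg.card_eq,
      (MonoidAlgebra.coeffLinearEquiv E).finrank_eq, Module.finrank_finsupp_self,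
      Nat.card_eq_fintype_card]
  have : Module.Finite E (MonoidAlgebra E N) := Module.Finite.of_surjective _ hsurj
  have hbij : Function.Bijective (ι.toLinearMap.liftBaseChange E) :=
    ⟨(LinearMap.injective_iff_surjective_of_finrank_eq_finrank hdim).2 hsurj, hsurj⟩
  refine ⟨LinearEquiv.ofBijective _ hbij, fun h => ?_⟩
  simp

include hN hrange in
/-- Every action of a form `H` of `E[N]` as a Hopf Galois structure on `L/K` is obtained from the
standard one by twisting with a `G`-equivariant automorphism of `N`, if the centralizer of `N`
is contained in `λ(G)`. -/
theorem exists_mulEquiv_action_eq [FiniteDimensional K L] [FiniteDimensional K E] [IsGalois K E]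
    (hreg : IsRegular N)
    (hcent : Subgroup.centralizer (N : Set (Equiv.Perm (Cosets K L E))) ≤ (lam K L E).range)
    (hcounit : ∀ h : H, Coalgebra.counit (R := E) (ι h) =
      algebraMap K E (Coalgebra.counit (R := K) h))
    (hcomul : ∀ h : H, Coalgebra.comul (R := E) (ι h) =
      TensorProduct.mapOfCompatibleSMul E K K (MonoidAlgebra E N) (MonoidAlgebra E N)
        (TensorProduct.map ι.toLinearMap ι.toLinearMap (Coalgebra.comul (R := K) h)))
    (S : HopfGaloisStructure K L H) :
    ∃ α : N ≃* N, (∀ g n, α (conjLam hN g n) = conjLam hN g (α n)) ∧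
      ∀ (h : H) (x : L), algebraMap L E (S.action h x) = (ι h).coeff.sum fun n c =>
        c * cosetEval ((α n : Equiv.Perm (Cosets K L E))⁻¹
          ((1 : E ≃ₐ[K] E) : Cosets K L E)) x := by
  obtain ⟨e, he⟩ := exists_baseChangeEquiv hN hrange hreg S.finrank_eq
  let T (q : Cosets K L E) : MonoidAlgebra E N →ₗ[E] (L →ₗ[K] E) :=
    S.transfer e (cosetAlgHom q).toLinearMap
  -- The inverse turns the right action into a left one and matches the `n⁻¹` in the standard
  -- action.
  have hr (n : N) (q : Cosets K L E) : ∃ p : Cosets K L E,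
      (cosetAlgHom p).toLinearMap = T q (MonoidAlgebra.single n⁻¹ 1) := by
    obtain ⟨p, hp⟩ := cosetAlgHom_surjective (K := K) (L := L) (E := E)
      (AlgHom.ofLinearMap (T q (MonoidAlgebra.single n⁻¹ 1))
        ((S.transfer_apply_one ι e he hcounit _ _).trans (by simp))
        (S.transfer_apply_mul ι e he hcomul _ _))
    exact ⟨p, by rw [hp]; rfl⟩
  choose r hr using hr
  have hinjAlg {p q : Cosets K L E}
      (h : (cosetAlgHom p).toLinearMap = (cosetAlgHom q).toLinearMap) : p = q :=
    cosetAlgHom_injective (AlgHom.toLinearMap_injective h)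
  have hr_mul (m n : N) (q : Cosets K L E) : r (m * n) q = r m (r n q) := by
    refine hinjAlg ?_
    simp only [hr, T, mul_inv_rev]
    rw [← S.transfer_mul ι e he, MonoidAlgebra.single_mul_single, mul_one]
  have hr_conj (g : E ≃ₐ[K] E) (n : N) (q : Cosets K L E) :
      r (conjLam hN g n) (lam K L E g q) = lam K L E g (r n q) := by
    have hlam (q : Cosets K L E) : (cosetAlgHom (lam K L E g q)).toLinearMap =
        g.toLinearMap ∘ₗ (cosetAlgHom q).toLinearMap :=
      LinearMap.ext fun x => cosetEval_lam g q x
    let c : Equiv.Perm N := ⟨conjLam hN g, conjLam hN g⁻¹,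
      fun n => by rw [← conjLam_mul, inv_mul_cancel, conjLam_one],
      fun n => by rw [← conjLam_mul, mul_inv_cancel, conjLam_one]⟩
    have hc (h : H) (m : N) : (ι h).coeff (c m) = g ((ι h).coeff m) :=
      (isInvariant_iff hN).1 (hrange.subset ⟨h, rfl⟩) g m
    refine hinjAlg ?_
    rw [hlam, hr, hr, conjLam_inv]
    ext x
    simp only [T, hlam]
    exact S.transfer_conj ι e he g c hc _ n⁻¹ x
  -- An element `g` with `λ(g)` centralizing `N` fixes `n` under conjugation, so `hr_conj` says that
  -- `r n` commutes with `λ(g)`.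
  have hα (n : N) : ∃ m : N, ∀ q, (m : Equiv.Perm (Cosets K L E)) q = r n q := by
    refine hreg.exists_eq_of_commute (r n) fun c hc q => ?_
    obtain ⟨g, rfl⟩ := hcent hc
    have : conjLam hN g n = n := by
      ext1
      rw [coe_conjLam, ← Subgroup.mem_centralizer_iff.1 hc n n.2, mul_inv_cancel_right]
    rw [← hr_conj, this]
  choose α hα using hα
  have hα_mul (m n : N) : α (m * n) = α m * α n := by
    ext q : 2
    simp [hα, hr_mul]
  -- Injectivity comes from the Galois condition, via `transfer_injective`.
  have hα_inj : Function.Injective α := by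
    intro m n hmn
    have h1 : T (1 : E ≃ₐ[K] E) (MonoidAlgebra.single m⁻¹ 1) =
        T (1 : E ≃ₐ[K] E) (MonoidAlgebra.single n⁻¹ 1) := by
      rw [← hr, ← hr, ← hα, ← hα, hmn]
    have h2 := S.transfer_injective e _ h1
    exact inv_injective (MonoidAlgebra.single_left_injective one_ne_zero h2)
  refine ⟨MulEquiv.ofBijective (MonoidHom.mk' α hα_mul)
    (Finite.injective_iff_bijective.1 hα_inj), fun g n => ?_, fun h x => ?_⟩
  · ext q : 2
    obtain ⟨p, rfl⟩ := (lam K L E g).surjective q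
    simp [coe_conjLam, hα, hr_conj]
  · have h1 : algebraMap L E (S.action h x) = T (1 : E ≃ₐ[K] E) (ι h) x :=
      (S.transfer_form ι e he
        (cosetAlgHom ((1 : E ≃ₐ[K] E) : Cosets K L E)).toLinearMap h x).symm
    have h2 (n : N) : T (1 : E ≃ₐ[K] E) (MonoidAlgebra.single n 1) x =
        cosetEval ((α n : Equiv.Perm (Cosets K L E))⁻¹ ((1 : E ≃ₐ[K] E) : Cosets K L E)) x := by
      have h3 : α n⁻¹ = (α n)⁻¹ := map_inv (MonoidHom.mk' α hα_mul) n
      rw [← Subgroup.coe_inv, ← h3, hα, ← cosetAlgHom_apply, ← AlgHom.toLinearMap_apply, hr,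
        inv_inv]
    rw [h1]
    conv_lhs => rw [← MonoidAlgebra.sum_coeff_single (ι h)]
    rw [Finsupp.sum, map_sum, LinearMap.sum_apply, Finsupp.sum]
    refine Finset.sum_congr rfl fun n _ => ?_
    rw [← mul_one ((ι h).coeff n), ← smul_eq_mul, ← MonoidAlgebra.smul_single, map_smul,
      LinearMap.smul_apply, h2]
    simp

omit [Coalgebra.IsCocomm K H] [Module.Finite K H] in
-- Identified through `e`, the map is `t ↦ 1 ⊗ t` into `E ⊗ (H ⊗ H)`, injective by faithful
-- flatness. It lets compatibility with comultiplication be checked in `E[N] ⊗ E[N]`.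
theorem injective_mapOfCompatibleSMul_comp_map {N : Type*} [Group N]
    {ι : H →ₐ[K] MonoidAlgebra E N}
    (e : E ⊗[K] H ≃ₗ[E] MonoidAlgebra E N) (he : ∀ h, e (1 ⊗ₜ h) = ι h) :
    Function.Injective
      (TensorProduct.mapOfCompatibleSMul E K K (MonoidAlgebra E N) (MonoidAlgebra E N) ∘ₗ
        TensorProduct.map ι.toLinearMap ι.toLinearMap) := by
  let f : E ⊗[K] (H ⊗[K] H) ≃ₗ[E] MonoidAlgebra E N ⊗[E] MonoidAlgebra E N :=
    TensorProduct.AlgebraTensorModule.distribBaseChange K E H H ≪≫ₗ TensorProduct.congr e e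
  have hf (t : H ⊗[K] H) :
      (TensorProduct.mapOfCompatibleSMul E K K (MonoidAlgebra E N) (MonoidAlgebra E N) ∘ₗ
        TensorProduct.map ι.toLinearMap ι.toLinearMap) t = f (1 ⊗ₜ t) := by
    induction t using TensorProduct.induction_on with
    | zero => simp
    | add s t hs ht => rw [map_add, hs, ht, TensorProduct.tmul_add, map_add]
    | tmul x y => simp [f, he]
  intro s t hst
  rw [hf, hf] at hst
  exact Module.FaithfullyFlat.tensorProduct_mk_injective (A := K) (B := E) (H ⊗[K] H)
    (f.injective hst)

omit [Coalgebra.IsCocomm K H] in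
include hN hinj hrange in
/-- A `G`-equivariant automorphism of `N` induces an automorphism of every form of `E[N]`. -/
theorem exists_bialgEquiv (e : E ⊗[K] H ≃ₗ[E] MonoidAlgebra E N) (he : ∀ h, e (1 ⊗ₜ h) = ι h)
    (hcounit : ∀ h : H, Coalgebra.counit (R := E) (ι h) =
      algebraMap K E (Coalgebra.counit (R := K) h))
    (hcomul : ∀ h : H, Coalgebra.comul (R := E) (ι h) =
      TensorProduct.mapOfCompatibleSMul E K K (MonoidAlgebra E N) (MonoidAlgebra E N)
        (TensorProduct.map ι.toLinearMap ι.toLinearMap (Coalgebra.comul (R := K) h)))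
    (α : N ≃* N) (hα : ∀ g n, α (conjLam hN g n) = conjLam hN g (α n)) :
    ∃ ψ : H ≃ₐc[K] H, ∀ h n, (ι (ψ h)).coeff (α n) = (ι h).coeff n := by
  let β : MonoidAlgebra E N →ₐc[E] MonoidAlgebra E N :=
    MonoidAlgebra.mapDomainBialgHom E α.toMonoidHom
  have hβ (c : MonoidAlgebra E N) (n : N) : (β c).coeff (α n) = c.coeff n :=
    Finsupp.mapDomain_apply α.injective _ _
  have hβ_inj : Function.Injective β := fun c d hcd => by
    ext n
    rw [← hβ c, ← hβ d, hcd]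
  have hmem (h : H) : β (ι h) ∈ ι.range := by
    change β (ι h) ∈ Set.range ι
    rw [hrange, Set.mem_ofPred_eq, isInvariant_iff hN]
    intro g n
    obtain ⟨n, rfl⟩ := α.surjective n
    rw [← hα, hβ, hβ]
    exact (isInvariant_iff hN).1 (hrange.subset ⟨h, rfl⟩) g n
  -- Equivariance of `α` makes `β` preserve the invariants, that is `ι(H)`; `ψ` is its restriction
  -- there.
  let ψ : H →ₐ[K] H := (AlgEquiv.ofInjective ι hinj).symm.toAlgHom.comp
    ((((β : MonoidAlgebra E N →ₐ[E] MonoidAlgebra E N).restrictScalars K).comp ι).codRestrict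
      ι.range hmem)
  have hψ (h : H) : ι (ψ h) = β (ι h) :=
    congrArg Subtype.val ((AlgEquiv.ofInjective ι hinj).apply_symm_apply ⟨β (ι h), hmem h⟩)
  have hψ_inj : Function.Injective ψ := fun x y hxy => hinj (hβ_inj (by rw [← hψ, ← hψ, hxy]))
  have hψ_bij : Function.Bijective ψ :=
    ⟨hψ_inj, LinearMap.surjective_of_injective (f := ψ.toLinearMap) hψ_inj⟩
  refine ⟨BialgEquiv.ofAlgEquiv (AlgEquiv.ofBijective ψ hψ_bij) ?_ ?_, fun h n => ?_⟩
  · refine AlgHom.ext fun h => (algebraMap K E).injective ?_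
    change algebraMap K E (Coalgebra.counit (R := K) (ψ h)) =
      algebraMap K E (Coalgebra.counit (R := K) h)
    rw [← hcounit, ← hcounit, hψ, CoalgHomClass.counit_comp_apply]
  · refine AlgHom.ext fun h => injective_mapOfCompatibleSMul_comp_map e he ?_
    change _ = TensorProduct.mapOfCompatibleSMul E K K (MonoidAlgebra E N) (MonoidAlgebra E N)
      (TensorProduct.map ι.toLinearMap ι.toLinearMap (Coalgebra.comul (R := K) (ψ h)))
    rw [← hcomul, hψ, ← CoalgHomClass.map_comp_comul_apply, hcomul]
    change TensorProduct.mapOfCompatibleSMul E K K (MonoidAlgebra E N) (MonoidAlgebra E N)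
      (TensorProduct.map ι.toLinearMap ι.toLinearMap
        (TensorProduct.map ψ.toLinearMap ψ.toLinearMap (Coalgebra.comul (R := K) h))) = _
    induction Coalgebra.comul (R := K) h using TensorProduct.induction_on with
    | zero => simp
    | add s t hs ht => simp only [map_add, hs, ht]
    | tmul x y => simp [hψ]
  · change (ι (ψ h)).coeff (α n) = _
    rw [hψ, hβ]

end Form

end GreitherPareigis

/-! ### Uniqueness of the structure -/

theorem mainTheorem1 {K L E H H' : Type*} [Field K] [Field L] [Field E]
    [Algebra K L] [Algebra K E] [Algebra L E] [IsScalarTower K L E]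
    [FiniteDimensional K L] [Algebra.IsSeparable K L] [IsNormalClosure K L E]
    [Ring H] [HopfAlgebra K H] [Coalgebra.IsCocomm K H] [Module.Finite K H]
    [Ring H'] [HopfAlgebra K H'] [Coalgebra.IsCocomm K H'] [Module.Finite K H']
    (S : HopfGaloisStructure K L H) (S' : HopfGaloisStructure K L H')
    (hS : GreitherPareigis.IsAlmostClassicallyGalois E S)
    (hH : Nonempty (H ≃ₐc[K] H')) :
    S.Isomorphic S' := by
  obtain ⟨f⟩ := hH
  obtain ⟨N, ⟨hreg, hN, ι, hinj, hrange, hcounit, hcomul, hact⟩, hcent⟩ := hS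
  have : FiniteDimensional K E := IsNormalClosure.finiteDimensional K L E
  have : IsGalois K E := IsNormalClosure.isGalois K L E
  obtain ⟨e, he⟩ := GreitherPareigis.exists_baseChangeEquiv hN hrange hreg S.finrank_eq
  obtain ⟨α, hα, hα_act⟩ := GreitherPareigis.exists_mulEquiv_action_eq hN hrange hreg hcent
    hcounit hcomul (S'.comap f)
  obtain ⟨ψ, hψ⟩ := GreitherPareigis.exists_bialgEquiv hN hinj hrange e he hcounit hcomul α hα
  have key (h : H) : S'.action (f h) = S.action (ψ h) := by
    ext x
    refine (algebraMap L E).injective ?_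
    rw [← S'.comap_action f, hα_act, hact]
    have : Fintype N := Fintype.ofFinite N
    rw [Finsupp.sum_fintype _ _ (by simp), Finsupp.sum_fintype _ _ (by simp)]
    -- Substituting `α n` for the summation index absorbs the twist into `ψ`.
    exact Fintype.sum_equiv α.toEquiv _ _ fun n => by
      rw [← hψ]
      rfl
  refine ⟨ψ.symm.trans f, fun h => ?_⟩
  change S'.action (f (ψ.symm h)) = _
  rw [key, BialgEquiv.apply_symm_apply]
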